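/- Let $\tau$ be Ramanujan's function, defined by $\sum_{n\ge 1}\tau(n)x^n = x\prod_{k\ge 1}(1-x^k)^{24}$. For an arithmetic function $f$, a prime $p$ and an integer $m\ge 0$, define the characteristic functions $L_r(f;p^m)$, $r\ge 0$, recursively by $$L_0(f;p^m)=f(p^m),\qquad L_r(f;p^m)=f(p^{m+r})-\sum_{j=0}^{r-1}L_j(f;p^m)\,f(p^{r-j})\quad(r\ge 1).$$ Then for every prime $p$: (i) $L_0(\tau;p^m)=\tau(p^m)$ for all $m\ge 0$; (ii) $L_1(\tau;p^m)=-p^{11}\,\tau(p^{m-1})$ for all $m\ge 1$, and $L_1(\tau;1)=0$ for $m=0$ (i.e. the same formula with the convention $\tau(p^{-1})=0$); (iii) $L_r(\tau;p^m)=0$ for all $m\ge 0$ and all $r\ge 2$. -/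

import Mathlib

open scoped PowerSeries.WithPiTopology in
/-- The infinite product in the generating function below converges in `ℤ⟦X⟧` (topology of
coefficientwise convergence). -/
theorem multipliable_one_sub_X_pow_pow_24 :
    Multipliable fun k : ℕ => ((1 : PowerSeries ℤ) - PowerSeries.X ^ (k + 1)) ^ 24 :=
  (PowerSeries.WithPiTopology.multipliable_one_sub_X_pow ℤ).pow 24

open scoped PowerSeries.WithPiTopology in
/-- The generating function `x ∏_{k ≥ 1} (1 - x ^ k) ^ 24` of Ramanujan's `τ` function, as a formal
power series with integer coefficients. -/
noncomputable def ramanujanTauSeries : PowerSeries ℤ :=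
  PowerSeries.X * ∏' k : ℕ, (1 - PowerSeries.X ^ (k + 1)) ^ 24

/-- Ramanujan's `τ` function: `∑_{n ≥ 1} τ(n) x ^ n = x ∏_{k ≥ 1} (1 - x ^ k) ^ 24`. -/
noncomputable def ramanujanTau (n : ℕ) : ℤ :=
  PowerSeries.coeff n ramanujanTauSeries

/-- The characteristic functions `L_r(f; p ^ m)` of an arithmetic function `f`, defined by
`L_r(f; p ^ m) = f(p ^ (m + r)) - ∑_{j = 0}^{r - 1} L_j(f; p ^ m) f(p ^ (r - j))`
(for `r = 0` the sum is empty). -/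
def characteristicL {R : Type*} [CommRing R] (f : ℕ → R) (p m : ℕ) : ℕ → R
  | r => f (p ^ (m + r)) - ∑ j : Fin r, characteristicL f p m j * f (p ^ (r - (j : ℕ)))
termination_by r => r
decreasing_by exact j.isLt

/-- The defining recursion, with the sum written over `{0, …, r - 1}`. -/
theorem characteristicL_eq {R : Type*} [CommRing R] (f : ℕ → R) (p m r : ℕ) :
    characteristicL f p m r =
      f (p ^ (m + r)) - ∑ j ∈ Finset.range r, characteristicL f p m j * f (p ^ (r - j)) := by
  rw [characteristicL,
    Fin.sum_univ_eq_sum_range (fun j => characteristicL f p m j * f (p ^ (r - j))) r]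

/-! Everything follows from Mordell's recurrence τ(p^(m+2)) = τ(p) τ(p^(m+1)) - p^11 τ(p^m),
`ramanujanTau_prime_pow`. The q-coefficients of Δ are the τ(n), and level one cusp forms of weight
12 are multiples of Δ, so T_p Δ = c Δ. The coefficient of q gives c = τ(p), and that of q^(p^(m+1))
gives the recurrence. The recurrence gives L_1 directly. By induction it yields
`apply_prime_pow_add`: the terms j = 0, 1 of the sum already exhaust f(p^(m+r)), so L_r = 0 for r ≥
2. -/

open UpperHalfPlane Filter Topology

/-! ### The q-expansion of Δ -/

theorem TendstoLocallyUniformlyOn.iterate_deriv {ι : Type*} {φ : Filter ι} {U : Set ℂ}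
    {F : ι → ℂ → ℂ} {f : ℂ → ℂ} (hU : IsOpen U) (hf : TendstoLocallyUniformlyOn F f φ U)
    (hF : ∀ i, DifferentiableOn ℂ (F i) U) (n : ℕ) :
    TendstoLocallyUniformlyOn (fun i ↦ _root_.deriv^[n] (F i)) (_root_.deriv^[n] f) φ U := by
  induction n generalizing F f with
  | zero => exact hf
  | succ n ih =>
    exact ih (hf.deriv (.of_forall hF) hU) fun i ↦ (hF i).deriv hU

theorem TendstoLocallyUniformlyOn.fun_pow {ι X : Type*} [TopologicalSpace X] {φ : Filter ι}
    {U : Set X} {F : ι → X → ℂ} {f : X → ℂ} (hf : TendstoLocallyUniformlyOn F f φ U)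
    (hc : ContinuousOn f U) (n : ℕ) :
    TendstoLocallyUniformlyOn (fun i x ↦ F i x ^ n) (fun x ↦ f x ^ n) φ U := by
  induction n with
  | zero =>
    simp only [pow_zero]
    exact fun u hu x _ ↦ ⟨Set.univ, univ_mem, .of_forall fun _ _ _ ↦ refl_mem_uniformity hu⟩
  | succ n ih =>
    simp only [pow_succ]
    exact ih.fun_mul₀ hf (hc.pow n) hc

theorem Polynomial.iteratedDeriv_eval_zero (P : Polynomial ℂ) (n : ℕ) :
    iteratedDeriv n (fun q ↦ P.eval q) 0 = n.factorial * P.coeff n := by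
  have h : ∀ (n : ℕ) (P : Polynomial ℂ),
      deriv^[n] (fun q ↦ P.eval q) = fun q ↦ (Polynomial.derivative^[n] P).eval q := by
    intro n
    induction n with
    | zero => intro P; rfl
    | succ n ih =>
      intro P
      rw [Function.iterate_succ_apply, Function.iterate_succ_apply, ← ih]
      congr 1
      ext q
      exact P.deriv
  rw [iteratedDeriv_eq_iterate, h]
  beta_reduce
  rw [← Polynomial.coeff_zero_eq_eval_zero,
    Polynomial.coeff_iterate_derivative]
  simp [Nat.descFactorial_self]

/-- The partial products of the series `x ∏ (1 - x ^ k) ^ 24`, as integer polynomials. -/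
noncomputable def tauPartialProd (s : Finset ℕ) : Polynomial ℤ :=
  Polynomial.X * ∏ k ∈ s, (1 - Polynomial.X ^ (k + 1)) ^ 24

open scoped PowerSeries.WithPiTopology in
theorem eventually_coeff_tauPartialProd (n : ℕ) :
    ∀ᶠ s in atTop, (tauPartialProd s).coeff n = ramanujanTau n := by
  have h : Tendsto (fun s : Finset ℕ ↦ PowerSeries.X * ∏ k ∈ s,
      ((1 : PowerSeries ℤ) - PowerSeries.X ^ (k + 1)) ^ 24) atTop (𝓝 ramanujanTauSeries) :=
    Tendsto.const_mul _ multipliable_one_sub_X_pow_pow_24.hasProd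
  have h' := (PowerSeries.WithPiTopology.tendsto_iff_coeff_tendsto _ _ _ _).mp h n
  rw [nhds_discrete, tendsto_pure] at h'
  filter_upwards [h'] with s hs
  rw [ramanujanTau, ← hs, ← Polynomial.coeff_coe, tauPartialProd,
    ← Polynomial.coeToPowerSeries.ringHom_apply, map_mul, map_prod]
  simp

theorem tendstoLocallyUniformlyOn_tauPartialProd :
    TendstoLocallyUniformlyOn
      (fun s q ↦ ((tauPartialProd s).map (Int.castRingHom ℂ)).eval q)
      (fun q ↦ q * (∏' k : ℕ, (1 - q ^ (k + 1))) ^ 24) atTop (Metric.ball 0 1) := by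
  have h := (ModularForm.multipliableLocallyUniformlyOn_one_sub_pow.hasProdLocallyUniformlyOn)
  have hX : TendstoLocallyUniformlyOn (fun (_ : Finset ℕ) (q : ℂ) ↦ q) (fun q ↦ q) atTop
      (Metric.ball 0 1) :=
    fun u hu x _ ↦ ⟨Set.univ, univ_mem, .of_forall fun _ _ _ ↦ refl_mem_uniformity hu⟩
  have hc := ModularForm.differentiableOn_tprod_one_sub_pow.continuousOn
  convert TendstoLocallyUniformlyOn.fun_mul₀ hX (TendstoLocallyUniformlyOn.fun_pow h hc 24)
    continuousOn_id (hc.pow 24) using 3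
  simp [tauPartialProd, Polynomial.eval_prod, Polynomial.map_prod, Finset.prod_pow]

/-- The formal and the analytic product are limits of the same polynomials. Each coefficient is
eventually constant, while locally uniform convergence carries the derivatives at 0 to the limit. -/
theorem qExpansion_discriminant_coeff (n : ℕ) :
    (qExpansion 1 ModularForm.discriminant).coeff n = ramanujanTau n := by
  have hz : (0 : ℂ) ∈ Metric.ball (0 : ℂ) 1 := Metric.mem_ball_self one_pos
  have hlim := ((tendstoLocallyUniformlyOn_tauPartialProd.iterate_deriv Metric.isOpen_ball
    (fun s ↦ (Polynomial.differentiable _).differentiableOn) n).tendsto_at hz)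
  have hlim' : Tendsto (fun s ↦ iteratedDeriv n
      (fun q ↦ ((tauPartialProd s).map (Int.castRingHom ℂ)).eval q) 0) atTop
      (𝓝 (n.factorial * (ramanujanTau n : ℂ))) := by
    refine tendsto_const_nhds.congr' ?_
    filter_upwards [eventually_coeff_tauPartialProd n] with s hs
    simp [Polynomial.iteratedDeriv_eval_zero, hs]
  simp only [iteratedDeriv_eq_iterate] at hlim'
  have heq : iteratedDeriv n (cuspFunction 1 ModularForm.discriminant) 0
      = n.factorial * (ramanujanTau n : ℂ) := by
    rw [← tendsto_nhds_unique hlim hlim', ← iteratedDeriv_eq_iterate]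
    refine Filter.EventuallyEq.iteratedDeriv_eq n ?_
    filter_upwards [Metric.isOpen_ball.mem_nhds hz] with q hq
    rw [ModularForm.discriminant_cuspFunction_eqOn hq]
    beta_reduce
    rw [(ModularForm.multipliable_one_sub_pow (by simpa using hq)).tprod_pow]
  rw [qExpansion_coeff, heq, inv_mul_cancel_left₀ (by exact_mod_cast n.factorial_ne_zero)]

/-! ### The Hecke operator T_p in level one -/

open scoped MatrixGroups ModularForm Manifold

namespace Hecke

open Matrix Matrix.SpecialLinearGroup

variable (p : ℕ) [hp : Fact p.Prime]

/-- The matrix `(p, 0; 0, 1)`. -/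
noncomputable def diagMat : GL (Fin 2) ℝ :=
  GeneralLinearGroup.mkOfDetNeZero !![(p : ℝ), 0; 0, 1]
    (by simpa [det_fin_two] using hp.out.ne_zero)

/-- The matrix `(1, b; 0, p)`. -/
noncomputable def upperMat (b : ℤ) : GL (Fin 2) ℝ :=
  GeneralLinearGroup.mkOfDetNeZero !![1, (b : ℝ); 0, (p : ℝ)]
    (by simpa [det_fin_two] using hp.out.ne_zero)

@[simp] lemma val_diagMat : (diagMat p).val = !![(p : ℝ), 0; 0, 1] := rfl

@[simp] lemma val_upperMat (b : ℤ) : (upperMat p b).val = !![1, (b : ℝ); 0, (p : ℝ)] := rfl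

/-- The function `∑ f ∣[k] α`, where `α` runs over representatives `(p, 0; 0, 1)` and `(1, b; 0, p)`
of the integral matrices of determinant `p` modulo `SL(2, ℤ)`. -/
noncomputable def heckeFun (k : ℤ) (f : ℍ → ℂ) : ℍ → ℂ :=
  f ∣[k] diagMat p + ∑ b : ZMod p, f ∣[k] upperMat p b.val

variable {p} {k : ℤ} {f : ℍ → ℂ}

lemma val_diagMat_eq_map : (diagMat p).val = !![(p : ℤ), 0; 0, 1].map (algebraMap ℤ ℝ) := by
  ext i j
  fin_cases i <;> fin_cases j <;> simp

lemma val_upperMat_eq_map (b : ℤ) :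
    (upperMat p b).val = !![1, b; 0, (p : ℤ)].map (algebraMap ℤ ℝ) := by
  ext i j
  fin_cases i <;> fin_cases j <;> simp

lemma slash_slash_eq_of_mul_eq (hf : ∀ γ : SL(2, ℤ), f ∣[k] γ = f) {A C : GL (Fin 2) ℝ}
    {A' C' : Matrix (Fin 2) (Fin 2) ℤ} (hA : A.val = A'.map (algebraMap ℤ ℝ))
    (hC : C.val = C'.map (algebraMap ℤ ℝ)) (γ δ : SL(2, ℤ)) (h : A' * δ.val = γ.val * C') :
    (f ∣[k] A) ∣[k] δ = f ∣[k] C := by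
  have hmul : A * mapGL ℝ δ = mapGL ℝ γ * C := by
    ext1
    simp only [Units.val_mul, mapGL_coe_matrix, hA, hC, map_apply_coe, RingHom.mapMatrix_apply,
      ← Matrix.map_mul, h]
  change (f ∣[k] A) ∣[k] mapGL ℝ δ = _
  rw [← SlashAction.slash_mul, hmul, SlashAction.slash_mul]
  congr 1
  exact hf γ

lemma slash_upperMat_congr (hf : ∀ γ : SL(2, ℤ), f ∣[k] γ = f) {b c : ℤ}
    (h : (b : ZMod p) = c) : f ∣[k] upperMat p b = f ∣[k] upperMat p c := by
  obtain ⟨t, ht⟩ := (ZMod.intCast_eq_intCast_iff_dvd_sub _ _ _).mp h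
  obtain rfl : c = b + p * t := by linarith
  rw [← slash_slash_eq_of_mul_eq hf (val_upperMat_eq_map (p := p) b)
    (val_upperMat_eq_map (p := p) (b + p * t))
    ⟨!![1, -t; 0, 1], by simp⟩ 1 (by simp [mul_comm]), SlashAction.slash_one]

lemma heckeFun_slash_T (hf : ∀ γ : SL(2, ℤ), f ∣[k] γ = f) :
    heckeFun p k f ∣[k] ModularGroup.T = heckeFun p k f := by
  rw [heckeFun, SlashAction.add_slash, SlashAction.sum_slash]
  congr 1
  · refine slash_slash_eq_of_mul_eq hf val_diagMat_eq_map val_diagMat_eq_map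
      (ModularGroup.T ^ (p : ℤ)) _ ?_
    rw [ModularGroup.coe_T, ModularGroup.coe_T_zpow]
    simp
  · refine Fintype.sum_equiv (Equiv.addRight 1) _ _ fun b ↦ ?_
    -- The representative of b + 1 may wrap around mod p, hence the exchange for `b.val + 1`.
    rw [Equiv.coe_addRight, slash_upperMat_congr hf (b := (b + 1).val) (c := b.val + 1) (by simp)]
    refine slash_slash_eq_of_mul_eq hf (val_upperMat_eq_map _) (val_upperMat_eq_map _) 1 _ ?_
    simp [ModularGroup.T, add_comm]

lemma slash_upperMat_zero_slash_S (hf : ∀ γ : SL(2, ℤ), f ∣[k] γ = f) :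
    (f ∣[k] upperMat p 0) ∣[k] ModularGroup.S = f ∣[k] diagMat p :=
  slash_slash_eq_of_mul_eq hf (val_upperMat_eq_map _) val_diagMat_eq_map ModularGroup.S _
    (by simp [ModularGroup.S])

lemma slash_diagMat_slash_S (hf : ∀ γ : SL(2, ℤ), f ∣[k] γ = f) :
    (f ∣[k] diagMat p) ∣[k] ModularGroup.S = f ∣[k] upperMat p 0 :=
  slash_slash_eq_of_mul_eq hf val_diagMat_eq_map (val_upperMat_eq_map _) ModularGroup.S _
    (by simp [ModularGroup.S])

lemma slash_upperMat_slash_S (hf : ∀ γ : SL(2, ℤ), f ∣[k] γ = f) {b c : ℤ}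
    (h : (b * c : ZMod p) = -1) :
    (f ∣[k] upperMat p b) ∣[k] ModularGroup.S = f ∣[k] upperMat p c := by
  obtain ⟨t, ht⟩ : (p : ℤ) ∣ b * c + 1 := by
    rw [← ZMod.intCast_zmod_eq_zero_iff_dvd]
    push_cast
    rw [h, neg_add_cancel]
  -- Since bc + 1 = pt, the matrix below has determinant -bc + tp = 1.
  refine slash_slash_eq_of_mul_eq hf (val_upperMat_eq_map _) (val_upperMat_eq_map _)
    ⟨!![b, -t; p, -c], by rw [det_fin_two_of]; linarith⟩ _ ?_
  have : -1 = b * c + -(t * p) := by linarith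
  simp [ModularGroup.S, ← this, mul_comm]

/-- S swaps the representatives (p, 0; 0, 1) and (1, 0; 0, p), and permutes those with b ≠ 0 by b ↦
-1/b mod p. -/
lemma heckeFun_slash_S (hf : ∀ γ : SL(2, ℤ), f ∣[k] γ = f) :
    heckeFun p k f ∣[k] ModularGroup.S = heckeFun p k f := by
  rw [heckeFun, SlashAction.add_slash, SlashAction.sum_slash,
    Fintype.sum_eq_add_sum_compl (0 : ZMod p), Fintype.sum_eq_add_sum_compl (0 : ZMod p),
    ZMod.val_zero, Nat.cast_zero, slash_upperMat_zero_slash_S hf, slash_diagMat_slash_S hf,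
    add_left_comm]
  congr 2
  have hinv (b : ZMod p) : -(-b⁻¹)⁻¹ = b := by rw [inv_neg, neg_neg, inv_inv]
  have hmem (b : ZMod p) (hb : b ∈ ({0}ᶜ : Finset (ZMod p))) :
      -b⁻¹ ∈ ({0}ᶜ : Finset (ZMod p)) := by
    simpa only [Finset.mem_compl, Finset.mem_singleton, neg_eq_zero, inv_eq_zero] using hb
  refine Finset.sum_nbij' (fun b ↦ -b⁻¹) (fun b ↦ -b⁻¹) hmem hmem (fun b _ ↦ hinv b)
    (fun b _ ↦ hinv b) fun b hb ↦ slash_upperMat_slash_S hf ?_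
  have hb : b ≠ 0 := by simpa using hb
  rw [Int.cast_natCast, Int.cast_natCast, ZMod.natCast_zmod_val, ZMod.natCast_zmod_val, mul_neg,
    mul_inv_cancel₀ hb]

lemma heckeFun_slash (hf : ∀ γ : SL(2, ℤ), f ∣[k] γ = f) (γ : SL(2, ℤ)) :
    heckeFun p k f ∣[k] γ = heckeFun p k f :=
  SlashInvariantForm.slash_action_generators_SL2Z (heckeFun_slash_S hf) (heckeFun_slash_T hf) γ

variable (p) in
/-- The Hecke operator `T_p` on cusp forms of level one. -/
noncomputable def hecke (f : CuspForm 𝒮ℒ k) : CuspForm 𝒮ℒ k :=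
  have hf (γ : SL(2, ℤ)) : (⇑f) ∣[k] γ = f := f.slash_action_eq' _ ⟨γ, rfl⟩
  { toFun := heckeFun p k f
    slash_action_eq' := by
      rintro _ ⟨γ, rfl⟩
      exact heckeFun_slash hf γ
    holo' := by
      refine (f.holo'.slash k _).add ?_
      exact MDifferentiable.sum fun b _ ↦ f.holo'.slash k _
    zero_at_cusps' := fun {c} hc ↦ by
      rw [Subgroup.IsArithmetic.isCusp_iff_isCusp_SL2Z] at hc
      rw [OnePoint.isZeroAt_iff_forall_SL2Z hc]
      -- Invariance reduces every cusp to ∞, where upper triangular matrices preserve vanishing.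
      intro γ _
      rw [heckeFun_slash hf]
      have h0 : IsZeroAtImInfty f := CuspFormClass.zero_at_infty f
      have h1 := h0.slash k (g := diagMat p) (by simp)
      have h2 := tendsto_finsetSum Finset.univ
        fun (b : ZMod p) _ ↦ h0.slash k (g := upperMat p b.val) (by simp)
      simpa [IsZeroAtImInfty, ZeroAtFilter, heckeFun, Finset.sum_apply, Pi.add_def]
        using Tendsto.add h1 h2 }

@[simp] lemma coe_hecke (f : CuspForm 𝒮ℒ k) : ⇑(hecke p f) = heckeFun p k f := rfl

-- The q-expansion of T_p f

local notation "𝕢" => Function.Periodic.qParam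

lemma slash_diagMat_apply (τ : ℍ) :
    (f ∣[k] diagMat p) τ = (p : ℂ) ^ (k - 1) * f (diagMat p • τ) := by
  have hp0 : (0 : ℝ) < p := mod_cast hp.out.pos
  simp [ModularForm.slash_apply, σ, denom, hp0, mul_comm]

lemma slash_upperMat_apply (b : ℤ) (τ : ℍ) :
    (f ∣[k] upperMat p b) τ = (p : ℂ)⁻¹ * f (upperMat p b • τ) := by
  have hp0 : (0 : ℝ) < p := mod_cast hp.out.pos
  have hp1 : (p : ℂ) ≠ 0 := mod_cast hp.out.ne_zero
  simp [ModularForm.slash_apply, σ, denom, hp0, zpow_sub_one₀ hp1]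
  field_simp

lemma qParam_diagMat_smul (τ : ℍ) : 𝕢 1 (diagMat p • τ : ℍ) = 𝕢 1 τ ^ p := by
  have hp0 : (0 : ℝ) < p := mod_cast hp.out.pos
  rw [coe_smul_of_det_pos (by simpa [det_fin_two] using hp0)]
  simp only [Function.Periodic.qParam, ← Complex.exp_nat_mul, num, denom]
  congr 1
  simp
  ring

lemma qParam_upperMat_smul (b : ZMod p) (n : ℕ) (τ : ℍ) :
    𝕢 1 (upperMat p b.val • τ : ℍ) ^ n = 𝕢 p τ ^ n * ZMod.stdAddChar (b * (n : ZMod p)) := by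
  have hp0 : (0 : ℝ) < p := mod_cast hp.out.pos
  have hp1 : (p : ℂ) ≠ 0 := mod_cast hp.out.ne_zero
  have hb : b * (n : ZMod p) = ((b.val * n : ℤ) : ZMod p) := by simp
  rw [coe_smul_of_det_pos (by simpa [det_fin_two] using hp0), hb, ZMod.stdAddChar_coe]
  generalize b.val = c
  simp only [Function.Periodic.qParam, ← Complex.exp_nat_mul, ← Complex.exp_add, num, denom]
  congr 1
  simp
  field_simp

lemma qParam_pow_self (τ : ℍ) : 𝕢 p τ ^ p = 𝕢 1 τ := by
  have hp1 : (p : ℂ) ≠ 0 := mod_cast hp.out.ne_zero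
  simp only [Function.Periodic.qParam, ← Complex.exp_nat_mul]
  congr 1
  simp
  field_simp

lemma hasSum_slash_diagMat {a : ℕ → ℂ} (hf : ∀ τ : ℍ, HasSum (fun n ↦ a n • 𝕢 1 τ ^ n) (f τ))
    (τ : ℍ) : HasSum (fun n ↦ (if p ∣ n then (p : ℂ) ^ (k - 1) * a (n / p) else 0) • 𝕢 1 τ ^ n)
      ((f ∣[k] diagMat p) τ) := by
  rw [slash_diagMat_apply]
  have hinj : Function.Injective (fun n ↦ p * n) := mul_right_injective₀ hp.out.ne_zero
  rw [← hinj.hasSum_iff]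
  · convert! (hf (diagMat p • τ)).mul_left ((p : ℂ) ^ (k - 1)) using 2 with n
    simp [qParam_diagMat_smul, ← pow_mul, Nat.mul_div_cancel_left _ hp.out.pos, mul_assoc]
  · intro n hn
    rw [if_neg, zero_smul]
    rintro ⟨m, rfl⟩
    exact hn ⟨m, rfl⟩

lemma sum_stdAddChar_mul (n : ℕ) :
    ∑ b : ZMod p, ZMod.stdAddChar (b * (n : ZMod p)) = if p ∣ n then (p : ℂ) else 0 := by
  rw [AddChar.sum_mulShift _ (ZMod.isPrimitive_stdAddChar p)]
  simp [ZMod.natCast_eq_zero_iff, ZMod.card]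

/-- Orthogonality of additive characters keeps only the exponents divisible by p; the resulting
factor p cancels the p⁻¹ of the slash action. -/
lemma hasSum_sum_slash_upperMat {a : ℕ → ℂ}
    (hf : ∀ τ : ℍ, HasSum (fun n ↦ a n • 𝕢 1 τ ^ n) (f τ)) (τ : ℍ) :
    HasSum (fun n ↦ a (p * n) • 𝕢 1 τ ^ n) ((∑ b : ZMod p, f ∣[k] upperMat p b.val) τ) := by
  have hp1 : (p : ℂ) ≠ 0 := mod_cast hp.out.ne_zero
  have hinj : Function.Injective (fun n ↦ p * n) := mul_right_injective₀ hp.out.ne_zero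
  have h := hasSum_sum (s := Finset.univ)
    fun (b : ZMod p) _ ↦ (hf (upperMat p b.val • τ)).mul_left ((p : ℂ)⁻¹)
  have hterm (n : ℕ) : ∑ b : ZMod p, (p : ℂ)⁻¹ * a n • 𝕢 1 (upperMat p b.val • τ : ℍ) ^ n
      = if p ∣ n then a n * 𝕢 p τ ^ n else 0 := by
    simp only [qParam_upperMat_smul, smul_eq_mul, ← Finset.mul_sum, sum_stdAddChar_mul]
    split_ifs
    · field_simp
    · simp
  simp only [hterm] at h
  rw [← hinj.hasSum_iff] at h
  · convert! h using 2 with n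
    · simp [pow_mul, qParam_pow_self]
    · simp [Finset.sum_apply, slash_upperMat_apply]
  · intro n hn
    rw [if_neg]
    rintro ⟨m, rfl⟩
    exact hn ⟨m, rfl⟩

theorem qExpansion_hecke_coeff (f : CuspForm 𝒮ℒ k) (n : ℕ) :
    (qExpansion 1 (hecke p f)).coeff n = (qExpansion 1 f).coeff (p * n) +
      if p ∣ n then (p : ℂ) ^ (k - 1) * (qExpansion 1 f).coeff (n / p) else 0 := by
  have hf (τ : ℍ) := ModularForm.hasSum_qExpansion (f := f) one_pos one_mem_strictPeriods_SL τ
  refine (ModularFormClass.qExpansion_coeff_unique one_pos one_mem_strictPeriods_SL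
    (f := hecke p f) (c := fun n ↦ (qExpansion 1 f).coeff (p * n) +
      if p ∣ n then (p : ℂ) ^ (k - 1) * (qExpansion 1 f).coeff (n / p) else 0)
    (fun τ ↦ ?_) n).symm
  convert! (hasSum_sum_slash_upperMat (p := p) (k := k) hf τ).add
    (hasSum_slash_diagMat (p := p) (k := k) hf τ) using 2 with n
  · rw [add_smul]
  · rw [coe_hecke, heckeFun, add_comm, Pi.add_apply]

end Hecke

/-! ### Δ as an eigenform, and the recurrence for τ -/

/-- Division by Δ turns f into a level one form of weight 0, which is constant. -/
theorem CuspForm.exists_smul_discriminant_eq (f : CuspForm 𝒮ℒ 12) :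
    ∃ c : ℂ, f = c • CuspForm.discriminant := by
  obtain ⟨c, hc⟩ := ModularFormClass.levelOne_weight_zero_const (CuspForm.discriminantEquiv f)
  refine ⟨c, ?_⟩
  ext z
  rw [← ModularForm.discriminant_mul_discriminantEquiv_apply, hc]
  simp [mul_comm]

theorem ramanujanTau_one : ramanujanTau 1 = 1 := by
  have := ModularForm.discriminant_qExpansion_coeff_one
  rw [qExpansion_discriminant_coeff] at this
  exact_mod_cast this

theorem ramanujanTau_prime_mul {p : ℕ} (hp : p.Prime) (n : ℕ) :
    ramanujanTau (p * n) + (if p ∣ n then (p : ℤ) ^ 11 * ramanujanTau (n / p) else 0) =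
      ramanujanTau p * ramanujanTau n := by
  have : Fact p.Prime := ⟨hp⟩
  obtain ⟨c, hc⟩ := (Hecke.hecke p CuspForm.discriminant).exists_smul_discriminant_eq
  have h (n : ℕ) : (ramanujanTau (p * n) : ℂ) +
      (if p ∣ n then (p : ℂ) ^ 11 * (ramanujanTau (n / p) : ℂ) else 0) = c * ramanujanTau n := by
    have h1 := Hecke.qExpansion_hecke_coeff (p := p) CuspForm.discriminant n
    rw [hc, FunLike.coe_smul, ModularForm.qExpansion_smul one_pos one_mem_strictPeriods_SL] at h1
    simp only [CuspForm.coe_discriminant, PowerSeries.coeff_smul, qExpansion_discriminant_coeff,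
      smul_eq_mul] at h1
    simp only [h1, show (12 : ℤ) - 1 = (11 : ℕ) by rfl, zpow_natCast]
  have hc : c = ramanujanTau p := by
    have h1 := h 1
    rw [ramanujanTau_one, if_neg hp.not_dvd_one] at h1
    simpa using h1.symm
  have := h n
  rw [hc] at this
  exact_mod_cast this

theorem ramanujanTau_prime_pow {p : ℕ} (hp : p.Prime) (m : ℕ) :
    ramanujanTau (p ^ (m + 2)) =
      ramanujanTau p * ramanujanTau (p ^ (m + 1)) - (p : ℤ) ^ 11 * ramanujanTau (p ^ m) := by
  have := ramanujanTau_prime_mul hp (p ^ (m + 1))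
  rw [if_pos (dvd_pow_self p m.succ_ne_zero), ← pow_succ', pow_succ' p m,
    Nat.mul_div_cancel_left _ hp.pos] at this
  rw [pow_succ' p m]
  linarith

/-! ### Characteristic functions of a sequence with a two-term recurrence -/

section characteristicL

variable {R : Type*} [CommRing R] {f : ℕ → R} {p : ℕ} {q : R}

theorem characteristicL_zero (f : ℕ → R) (p m : ℕ) : characteristicL f p m 0 = f (p ^ m) := by
  simp [characteristicL_eq f p m 0]

theorem characteristicL_one (f : ℕ → R) (p m : ℕ) :
    characteristicL f p m 1 = f (p ^ (m + 1)) - f (p ^ m) * f p := by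
  simp [characteristicL_eq f p m 1, characteristicL_zero]

/-- As functions of r, both sides satisfy the same second-order recurrence, so agreement at r = 0, 1
suffices. -/
theorem apply_prime_pow_add (h1 : f 1 = 1)
    (h : ∀ m, f (p ^ (m + 2)) = f p * f (p ^ (m + 1)) - q * f (p ^ m)) (m r : ℕ) :
    f (p ^ (m + r + 1)) = f (p ^ m) * f (p ^ (r + 1)) +
      (f (p ^ (m + 1)) - f (p ^ m) * f p) * f (p ^ r) := by
  induction r using Nat.twoStepInduction with
  | zero => simp [h1]
  | one =>
    have h2 := h 0
    simp only [zero_add, pow_one, pow_zero, h1] at h2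
    rw [show m + 1 + 1 = m + 2 by rfl, h, show 1 + 1 = 2 by rfl, h2, pow_one]
    ring
  | more r ih1 ih2 =>
    rw [show m + (r + 2) + 1 = (m + r + 1) + 2 by ring, h, ih1,
      show m + r + 1 + 1 = m + (r + 1) + 1 by ring, ih2, show r + 2 + 1 = r + 1 + 2 by ring,
      h (r + 1), h r]
    ring

theorem characteristicL_eq_zero (h1 : f 1 = 1)
    (h : ∀ m, f (p ^ (m + 2)) = f p * f (p ^ (m + 1)) - q * f (p ^ m)) (m r : ℕ) :
    characteristicL f p m (r + 2) = 0 := by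
  induction r using Nat.strong_induction_on with
  | _ r ih =>
    -- Splitting off j = 0, 1 leaves terms that vanish by induction.
    rw [characteristicL_eq, Finset.sum_range_succ', Finset.sum_range_succ',
      Finset.sum_eq_zero fun j hj ↦ by rw [ih j (Finset.mem_range.mp hj), zero_mul]]
    have := apply_prime_pow_add h1 h m (r + 1)
    simp only [zero_add, characteristicL_zero, characteristicL_one, Nat.sub_zero,
      show r + 2 - 1 = r + 1 by rfl]
    rw [show m + (r + 2) = m + (r + 1) + 1 by ring, this]
    ring

end characteristicL

theorem proposition2 (p : ℕ) (hp : p.Prime) :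
    (∀ m : ℕ, characteristicL ramanujanTau p m 0 = ramanujanTau (p ^ m)) ∧
    (∀ m : ℕ, 1 ≤ m →
      characteristicL ramanujanTau p m 1 = -(p : ℤ) ^ 11 * ramanujanTau (p ^ (m - 1))) ∧
    characteristicL ramanujanTau p 0 1 = 0 ∧
    (∀ m r : ℕ, 2 ≤ r → characteristicL ramanujanTau p m r = 0) := by
  refine ⟨characteristicL_zero _ _, fun m hm ↦ ?_, ?_, fun m r hr ↦ ?_⟩
  · obtain ⟨m, rfl⟩ := Nat.exists_eq_add_of_le' hm
    rw [characteristicL_one, ramanujanTau_prime_pow hp, Nat.add_sub_cancel]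
    ring
  · simp [characteristicL_one, ramanujanTau_one]
  · obtain ⟨r, rfl⟩ := Nat.exists_eq_add_of_le' hr
    exact characteristicL_eq_zero ramanujanTau_one (ramanujanTau_prime_pow hp) m r
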